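/- Let \(A\) be a finite set of action labels and let \(v_0,v_1,v_2,\dots\) be countably many variables. Terms are given by the grammar \(v \mid ae \mid e_1+e_2 \mid \mu v\,e\) (\(v\) a variable, \(a\in A\)), where \(\mu v\) binds \(v\). Let \(\mathsf{Term}\) be the set of closed guarded terms, i.e. terms without free variables such that in every subterm \(\mu v\,e\) each free occurrence of \(v\) in \(e\) lies within the scope of an action prefix \(a(-)\) inside \(e\). Write \(e[g/v]\) for the result of replacing each free occurrence of \(v\) in \(e\) by \(g\). The transition relations \(\xrightarrow{a}\) on \(\mathsf{Term}\) are the least relations such that \(ae\xrightarrow{a}e\); if \(e_1\xrightarrow{a}f\) or \(e_2\xrightarrow{a}f\), then \(e_1+e_2\xrightarrow{a}f\); and if \(e[\mu v\,e/v]\xrightarrow{a}f\), then \(\mu v\,e\xrightarrow{a}f\). A term \(e\in\mathsf{Term}\) emits the stream \((a_1,a_2,\dots)\in A^{\omega}\) if for every \(n\) there is a path \(e\xrightarrow{a_1}e_1\xrightarrow{a_2}\cdots\xrightarrow{a_n}e_n\). For a complete metric space \((M,d)\) and a contraction operator interpretation \(\sigma\), i.e. a map assigning to each \(a\in A\) a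 function \(\sigma_a:M\to M\) with \(d(\sigma_a(x),\sigma_a(y))\le r_a\,d(x,y)\) for all \(x,y\in M\) and some \(r_a\in[0,1)\), let \[ [\![e]\!]_\sigma=\Bigl\{\lim_{n\to\infty}\sigma_{a_1}\cdots\sigma_{a_n}(x)\;\Bigm|\;(a_1,a_2,\dots)\text{ is emitted by }e\Bigr\}, \] where the limit does not depend on \(x\in M\). For \(e,f\in\mathsf{Term}\), write \(e\approx f\) if \([\![e]\!]_\sigma=[\![f]\!]_\sigma\) for every complete metric space \((M,d)\) and every contraction operator interpretation \(\sigma\) in \((M,d)\). Let \(\equiv\) be the smallest equivalence relation on \(\mathsf{Term}\) that contains all instances, both sides of which are in \(\mathsf{Term}\), of the axioms - (ID) \(e+e\equiv e\), - (CM) \(e_2+e_1\equiv e_1+e_2\), - (AS) \(e_1+(e_2+e_3)\equiv(e_1+e_2)+e_3\), - (DS) \(a(e_1+e_2)\equiv ae_1+ae_2\), - (FP) \(\mu v\,e\equiv e[\mu v\,e/v]\), - (AE) \(\mu w\,e\equiv\mu v\,e[v/w]\), provided \(v\) is not free in \(e\) and no free occurrence of \(w\) in \(e\) lies within the scope of a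 \(\mu v(-)\), and is closed under the rules - (CN) if \(g\) is a term with free variables \(v_1,\dots,v_n\) and \(e_i\equiv f_i\) for \(i=1,\dots,n\), then \(g[\vec e/\vec v]\equiv g[\vec f/\vec v]\), provided both sides are in \(\mathsf{Term}\), - (UA) if \(g\equiv e[g/v]\) and \(\mu v\,e\in\mathsf{Term}\), then \(g\equiv\mu v\,e\). **Theorem (Completeness).** For all \(e,f\in\mathsf{Term}\), if \(e\approx f\), then \(e\equiv f\). -/

import Mathlib

open Filter Topology

universe u v

/-! ### Labelled transition systems, traces and streams -/

/-- A labelled transition system with labels `A` and states `X`, given by its transition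
function `X → 𝒫(A × X)`; `x` emits `a` and transitions to `y` when `(a, y) ∈ α x`. -/
abbrev LTS (A X : Type u) : Type u := X → Set (A × X)

namespace LTS

variable {A X : Type u}

/-- There is a path from the state `x` whose successive labels spell the given word. -/
def EmitsWord (α : LTS A X) : X → List A → Prop
  | _, [] => True
  | x, a :: w => ∃ y, (a, y) ∈ α x ∧ EmitsWord α y w

/-- The set of traces emitted by a state. -/
def tr (α : LTS A X) (x : X) : Set (List A) := {w | α.EmitsWord x w}

end LTS

/-- The prefix of length `n` of a stream. -/
def streamPrefix {A : Type u} (s : ℕ → A) (n : ℕ) : List A := (List.range n).map s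

/-- The set of streams emitted by a state: all finite prefixes are traces. -/
def LTS.str {A X : Type u} (α : LTS A X) (x : X) : Set (ℕ → A) :=
  {s | ∀ n, streamPrefix s n ∈ α.tr x}

/-! ### Terms -/

/-- Terms of the grammar `v | a e | e₁ + e₂ | μ v e`, with variables indexed by `ℕ`. -/
inductive RawTerm (A : Type u) : Type u
  | var (v : ℕ) : RawTerm A
  | act (a : A) (e : RawTerm A) : RawTerm A
  | add (e₁ e₂ : RawTerm A) : RawTerm A
  | mu (v : ℕ) (e : RawTerm A) : RawTerm A

namespace RawTerm

variable {A : Type u}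

/-- Free variables. -/
def fv : RawTerm A → Finset ℕ
  | var v => {v}
  | act _ e => e.fv
  | add e₁ e₂ => e₁.fv ∪ e₂.fv
  | mu v e => e.fv.erase v

/-- Simultaneous replacement of every free occurrence of each variable `v` by `s v`.
Bound variables are not renamed; no capture can occur when the replaced variables are
replaced by closed terms. -/
def subst : RawTerm A → (ℕ → RawTerm A) → RawTerm A
  | var v, s => s v
  | act a e, s => act a (e.subst s)
  | add e₁ e₂, s => add (e₁.subst s) (e₂.subst s)
  | mu v e, s => mu v (e.subst (Function.update s v (var v)))

/-- `e.subst₁ g v` is `e[g/v]`: every free occurrence of `v` in `e` is replaced by `g`. -/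
def subst₁ (e g : RawTerm A) (v : ℕ) : RawTerm A :=
  e.subst (Function.update var v g)

/-- Every free occurrence of `v` in the term lies within the scope of an action prefix. -/
def GuardedIn (v : ℕ) : RawTerm A → Prop
  | var w => w ≠ v
  | act _ _ => True
  | add e₁ e₂ => GuardedIn v e₁ ∧ GuardedIn v e₂
  | mu w e => w = v ∨ GuardedIn v e

/-- In every subterm `μ v e`, every free occurrence of `v` in `e` lies within the scope of an
action prefix inside `e`. -/
def Guarded : RawTerm A → Prop
  | var _ => True
  | act _ e => e.Guarded
  | add e₁ e₂ => e₁.Guarded ∧ e₂.Guarded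
  | mu v e => GuardedIn v e ∧ e.Guarded

/-- The term is closed and guarded. -/
def IsProc (e : RawTerm A) : Prop := e.fv = ∅ ∧ e.Guarded

/-- Replacing the free occurrences of `w` by the variable `v` captures nothing: no free
occurrence of `w` lies within the scope of a `μ v`. -/
def FreeFor (v w : ℕ) : RawTerm A → Prop
  | var _ => True
  | act _ e => FreeFor v w e
  | add e₁ e₂ => FreeFor v w e₁ ∧ FreeFor v w e₂
  | mu u e => w ∉ (mu u e).fv ∨ (u ≠ v ∧ FreeFor v w e)

/-- The transition relation of terms. -/
inductive Step : RawTerm A → A → RawTerm A → Prop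
  | act (a : A) (e : RawTerm A) : Step (act a e) a e
  | left {e₁ e₂ f : RawTerm A} {a : A} : Step e₁ a f → Step (add e₁ e₂) a f
  | right {e₁ e₂ f : RawTerm A} {a : A} : Step e₂ a f → Step (add e₁ e₂) a f
  | mu {v : ℕ} {e f : RawTerm A} {a : A} :
      Step (e.subst₁ (mu v e) v) a f → Step (mu v e) a f

/-- Derivability of equations between closed guarded terms from the axioms and rules
(ID), (CM), (AS), (DS), (FP), (CN), (AE), (UA) together with equational logic.
Both sides of a derivable equation are always closed and guarded, whereas the contexts `g` in
(CN) and the bodies `e` in (FP), (AE), (UA) may have free variables. -/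
inductive Derivable : RawTerm A → RawTerm A → Prop
  | refl {e : RawTerm A} : e.IsProc → Derivable e e
  | symm {e f : RawTerm A} : Derivable e f → Derivable f e
  | trans {e f g : RawTerm A} : Derivable e f → Derivable f g → Derivable e g
  | id {e : RawTerm A} : e.IsProc → Derivable (add e e) e
  | cm {e₁ e₂ : RawTerm A} : e₁.IsProc → e₂.IsProc → Derivable (add e₂ e₁) (add e₁ e₂)
  | as {e₁ e₂ e₃ : RawTerm A} : e₁.IsProc → e₂.IsProc → e₃.IsProc →
      Derivable (add e₁ (add e₂ e₃)) (add (add e₁ e₂) e₃)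
  | ds {a : A} {e₁ e₂ : RawTerm A} : e₁.IsProc → e₂.IsProc →
      Derivable (act a (add e₁ e₂)) (add (act a e₁) (act a e₂))
  | fp {v : ℕ} {e : RawTerm A} : (mu v e).IsProc →
      Derivable (mu v e) (e.subst₁ (mu v e) v)
  | cn {g : RawTerm A} {s t : ℕ → RawTerm A} : (∀ v ∈ g.fv, Derivable (s v) (t v)) →
      (g.subst s).IsProc → (g.subst t).IsProc → Derivable (g.subst s) (g.subst t)
  | ae {v w : ℕ} {e : RawTerm A} : (mu w e).IsProc → v ∉ e.fv → FreeFor v w e →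
      Derivable (mu w e) (mu v (e.subst₁ (var v) w))
  | ua {v : ℕ} {e g : RawTerm A} : Derivable g (e.subst₁ g v) → (mu v e).IsProc →
      Derivable g (mu v e)

end RawTerm

/-- Process terms: closed guarded terms. -/
def ProcTerm (A : Type u) : Type u := {e : RawTerm A // e.IsProc}

namespace ProcTerm

variable {A : Type u}

/-- The labelled transition system of process terms. -/
def γ : LTS A (ProcTerm A) := fun e => {p | RawTerm.Step e.1 p.1 p.2.1}

/-- Provable equivalence of process terms. -/
def ProvEquiv (e f : ProcTerm A) : Prop := RawTerm.Derivable e.1 f.1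

end ProcTerm

/-! ### Fractal semantics -/

/-- Contraction operators on a metric space. -/
def ContractionOp (M : Type v) [MetricSpace M] : Type v := {h : M → M // ∃ K, ContractingWith K h}

/-- `σ_{a₁} ⋯ σ_{aₙ}(x)`, the last letter of the word being applied first. -/
def applyWord {A : Type u} {M : Type v} [MetricSpace M] (σ : A → ContractionOp M) : List A → M → M
  | [], x => x
  | a :: w, x => (σ a).1 (applyWord σ w x)

/-- `p = lim_n σ_{a₁} ⋯ σ_{aₙ}(x)` for arbitrary `x`, where `s = (a₁, a₂, …)`. In a nonempty
complete metric space there is exactly one such point `p` for each stream. -/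
def IsStreamPoint {A : Type u} {M : Type v} [MetricSpace M] (σ : A → ContractionOp M) (s : ℕ → A)
    (p : M) : Prop :=
  ∀ x : M, Tendsto (fun n => applyWord σ (streamPrefix s n) x) atTop (𝓝 p)

/-- The set generated by a state `x`: the points given by the streams emitted by `x`. -/
def LTS.sem {A X : Type u} {M : Type v} [MetricSpace M] (α : LTS A X) (σ : A → ContractionOp M)
    (x : X) : Set M :=
  {p | ∃ s ∈ α.str x, IsStreamPoint σ s p}

/-- The regular subfractal semantics of a process term. -/
def ProcTerm.sem {A : Type u} {M : Type v} [MetricSpace M] (σ : A → ContractionOp M)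
    (e : ProcTerm A) : Set M :=
  LTS.sem ProcTerm.γ σ e

/-- Fractal equivalence: the same regular subfractal under every contraction operator
interpretation in every complete metric space. -/
def ProcTerm.FractalEquiv {A : Type u} (e f : ProcTerm A) : Prop :=
  ∀ (M : Type v) [MetricSpace M] [CompleteSpace M] (σ : A → ContractionOp M), e.sem σ = f.sem σ

/-!
The proof has a metric half and an algebraic half.

Metric half. On the space of streams over `A`, with two streams at distance `2⁻ⁿ` when they first
differ at place `n`, prefixing a letter is a contraction, and the point given by a stream is that
stream itself. Hence fractally equivalent terms emit the same streams
(`ProcTerm.FractalEquiv.str_eq`). A closed guarded term always has a transition, so every trace is a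
prefix of a stream, and equality of streams gives equality of traces.

Algebraic half. Terms with the same traces are provably equivalent (`ProcTerm.provEquiv_of_tr_eq`),
by determinization. Modulo provable equivalence, terms form a join semilattice under `+` by (ID),
(CM) and (AS), the action prefixes preserve joins by (DS), and by (FP) a term is the join of the
monomials `a f` over its transitions (`ProcTerm.isLUB_cls`). A term has finitely many derivatives
(`ProcTerm.exists_finite_closed`). Consider the pairs `(S, T)` of nonempty sets of derivatives of `e`
and of `f` such that `S` and `T` have the same traces. Such a pair has a successor of the same kind
for each first letter of its traces, which yields a finite guarded system of equations indexed by the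
pairs. The sums of the sets `S` solve it, and so do the sums of the sets `T`
(`ProcTerm.isLUB_succs`). By (UA) and (CN), a finite guarded system has at most one solution
(`RawTerm.derivable_of_solution`), and the pair `({e}, {f})` gives `e ≡ f`.

The rule (AE) is not needed, as the bound variables of the terms built in solving a system are chosen
apart from the free ones.
-/

namespace RawTerm

variable {A : Type u}

/-! ### Substitution -/

theorem subst_congr {e : RawTerm A} {s t : ℕ → RawTerm A} (h : ∀ v ∈ e.fv, s v = t v) :
    e.subst s = e.subst t := by
  induction e generalizing s t with
  | var v => exact h v (by simp [fv])
  | act a e ih => simp only [subst, ih h]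
  | add e₁ e₂ ih₁ ih₂ =>
    simp only [fv, Finset.mem_union] at h
    simp only [subst, ih₁ fun v hv => h v (.inl hv), ih₂ fun v hv => h v (.inr hv)]
  | mu v e ih =>
    simp only [fv, Finset.mem_erase] at h
    rw [subst, subst, ih]
    intro w hw
    by_cases hwv : w = v
    · simp [hwv]
    · simp [hwv, h w ⟨hwv, hw⟩]

theorem subst_var (e : RawTerm A) : e.subst var = e := by
  induction e with
  | var v => rfl
  | act a e ih => rw [subst, ih]
  | add e₁ e₂ ih₁ ih₂ => rw [subst, ih₁, ih₂]
  | mu v e ih => rw [subst, Function.update_eq_self, ih]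

theorem exists_of_mem_fv_subst {e : RawTerm A} {s : ℕ → RawTerm A} {v : ℕ}
    (h : v ∈ (e.subst s).fv) : ∃ w ∈ e.fv, v ∈ (s w).fv := by
  induction e generalizing s with
  | var w => exact ⟨w, by simp [fv], h⟩
  | act a e ih => exact ih h
  | add e₁ e₂ ih₁ ih₂ =>
    simp only [subst, fv, Finset.mem_union] at h ⊢
    rcases h with h | h
    · obtain ⟨w, hw, hv⟩ := ih₁ h
      exact ⟨w, .inl hw, hv⟩
    · obtain ⟨w, hw, hv⟩ := ih₂ h
      exact ⟨w, .inr hw, hv⟩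
  | mu u e ih =>
    simp only [subst, fv, Finset.mem_erase] at h ⊢
    obtain ⟨w, hw, hv⟩ := ih h.2
    by_cases hwu : w = u
    · subst hwu
      simp [fv, h.1] at hv
    · exact ⟨w, ⟨hwu, hw⟩, by simpa [hwu] using hv⟩

theorem fv_subst_eq_empty {e : RawTerm A} {s : ℕ → RawTerm A} (h : ∀ v ∈ e.fv, (s v).fv = ∅) :
    (e.subst s).fv = ∅ := by
  refine Finset.eq_empty_of_forall_notMem fun v hv => ?_
  obtain ⟨w, hw, hvw⟩ := exists_of_mem_fv_subst hv
  simp [h w hw] at hvw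

/-- The substitution `s` captures no variable in the term: no term substituted in the scope of a
`μ v` has `v` free, except for `v` itself. -/
def CaptureFree : RawTerm A → (ℕ → RawTerm A) → Prop
  | var _, _ => True
  | act _ e, s => e.CaptureFree s
  | add e₁ e₂, s => e₁.CaptureFree s ∧ e₂.CaptureFree s
  | mu v e, s => (∀ w ∈ e.fv, w ≠ v → v ∉ (s w).fv) ∧ e.CaptureFree (Function.update s v (var v))

/-- All bound variables of the term are at least `k`. -/
def BindersGE (k : ℕ) : RawTerm A → Prop
  | var _ => True
  | act _ e => e.BindersGE k
  | add e₁ e₂ => e₁.BindersGE k ∧ e₂.BindersGE k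
  | mu v e => k ≤ v ∧ e.BindersGE k

theorem BindersGE.mono {k l : ℕ} (hkl : k ≤ l) {e : RawTerm A} (h : e.BindersGE l) :
    e.BindersGE k := by
  induction e with
  | var _ => trivial
  | act _ e ih => exact ih h
  | add e₁ e₂ ih₁ ih₂ => exact ⟨ih₁ h.1, ih₂ h.2⟩
  | mu v e ih => exact ⟨hkl.trans h.1, ih h.2⟩

theorem bindersGE_zero (e : RawTerm A) : e.BindersGE 0 := by
  induction e with
  | var _ => trivial
  | act _ e ih => exact ih
  | add e₁ e₂ ih₁ ih₂ => exact ⟨ih₁, ih₂⟩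
  | mu v e ih => exact ⟨Nat.zero_le _, ih⟩

theorem BindersGE.subst {k : ℕ} {e : RawTerm A} {s : ℕ → RawTerm A} (he : e.BindersGE k)
    (hs : ∀ v ∈ e.fv, (s v).BindersGE k) : (e.subst s).BindersGE k := by
  induction e generalizing s with
  | var v => exact hs v (by simp [fv])
  | act a e ih => exact ih he hs
  | add e₁ e₂ ih₁ ih₂ =>
    simp only [fv, Finset.mem_union] at hs
    exact ⟨ih₁ he.1 fun v hv => hs v (.inl hv), ih₂ he.2 fun v hv => hs v (.inr hv)⟩
  | mu v e ih =>
    simp only [fv, Finset.mem_erase] at hs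
    refine ⟨he.1, ih he.2 fun w hw => ?_⟩
    by_cases hwv : w = v
    · simp [hwv, BindersGE]
    · simpa [hwv] using hs w ⟨hwv, hw⟩

theorem BindersGE.captureFree {k : ℕ} {e : RawTerm A} {s : ℕ → RawTerm A} (he : e.BindersGE k)
    (hs : ∀ w ∈ e.fv, s w = var w ∨ ∀ u ∈ (s w).fv, u < k) : e.CaptureFree s := by
  induction e generalizing s with
  | var v => trivial
  | act a e ih => exact ih he hs
  | add e₁ e₂ ih₁ ih₂ =>
    simp only [fv, Finset.mem_union] at hs
    exact ⟨ih₁ he.1 fun v hv => hs v (.inl hv), ih₂ he.2 fun v hv => hs v (.inr hv)⟩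
  | mu v e ih =>
    simp only [fv, Finset.mem_erase] at hs
    refine ⟨fun w hw hwv hv => ?_, ih he.2 fun w hw => ?_⟩
    · rcases hs w ⟨hwv, hw⟩ with h | h
      · rw [h, fv, Finset.mem_singleton] at hv
        exact hwv hv.symm
      · exact absurd (h v hv) (not_lt.2 he.1)
    · by_cases hwv : w = v
      · simp [hwv]
      · simpa [hwv] using hs w ⟨hwv, hw⟩

theorem captureFree_of_closed {e : RawTerm A} {s : ℕ → RawTerm A}
    (hs : ∀ w ∈ e.fv, s w = var w ∨ (s w).fv = ∅) : e.CaptureFree s :=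
  e.bindersGE_zero.captureFree fun w hw => (hs w hw).imp_right fun h => by simp [h]

theorem CaptureFree.subst_subst {e : RawTerm A} {s : ℕ → RawTerm A} (h : e.CaptureFree s)
    (t : ℕ → RawTerm A) : (e.subst s).subst t = e.subst fun w => (s w).subst t := by
  induction e generalizing s t with
  | var v => rfl
  | act a e ih => simp only [subst, ih h]
  | add e₁ e₂ ih₁ ih₂ => simp only [subst, ih₁ h.1, ih₂ h.2]
  | mu v e ih =>
    simp only [subst, ih h.2]
    congr 1
    refine subst_congr fun w hw => ?_
    by_cases hwv : w = v
    · simp [hwv, subst]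
    · simp only [Function.update_of_ne hwv]
      refine subst_congr fun u hu => ?_
      have : u ≠ v := fun huv => h.1 w hw hwv (huv ▸ hu)
      simp [this]

/-- Substituting closed terms for the variables other than `v`, and then `g` for `v`, is one
simultaneous substitution. -/
theorem subst_update_subst₁ {e : RawTerm A} {s : ℕ → RawTerm A} {v : ℕ} {g : RawTerm A}
    (hs : ∀ w ∈ e.fv, w ≠ v → (s w).fv = ∅) :
    (e.subst (Function.update s v (var v))).subst₁ g v = e.subst (Function.update s v g) := by
  rw [subst₁, CaptureFree.subst_subst]
  · refine subst_congr fun w hw => ?_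
    by_cases hwv : w = v
    · simp [hwv, subst]
    · simp only [Function.update_of_ne hwv]
      conv_rhs => rw [← (s w).subst_var]
      exact subst_congr (by simp [hs w hw hwv])
  · refine captureFree_of_closed fun w hw => ?_
    by_cases hwv : w = v
    · simp [hwv]
    · simp [hwv, hs w hw hwv]

/-! ### Guardedness -/

theorem guardedIn_of_notMem_fv {v : ℕ} {e : RawTerm A} (h : v ∉ e.fv) : GuardedIn v e := by
  induction e with
  | var w => simpa [fv, GuardedIn, eq_comm] using h
  | act a e ih => trivial
  | add e₁ e₂ ih₁ ih₂ =>
    simp only [fv, Finset.mem_union, not_or] at h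
    exact ⟨ih₁ h.1, ih₂ h.2⟩
  | mu w e ih =>
    by_cases hwv : w = v
    · exact .inl hwv
    · refine .inr (ih fun hv => h ?_)
      simp [fv, hv, Ne.symm hwv]

theorem GuardedIn.subst {v : ℕ} {e : RawTerm A} {s : ℕ → RawTerm A} (h : GuardedIn v e)
    (hs : ∀ w ∈ e.fv, w ≠ v → GuardedIn v (s w)) : GuardedIn v (e.subst s) := by
  induction e generalizing s with
  | var w => exact hs w (by simp [fv]) h
  | act a e ih => trivial
  | add e₁ e₂ ih₁ ih₂ =>
    simp only [fv, Finset.mem_union] at hs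
    exact ⟨ih₁ h.1 fun v hv => hs v (.inl hv), ih₂ h.2 fun v hv => hs v (.inr hv)⟩
  | mu u e ih =>
    simp only [fv, Finset.mem_erase] at hs
    by_cases huv : u = v
    · exact .inl huv
    · refine .inr (ih (h.resolve_left huv) fun w hw hwv => ?_)
      by_cases hwu : w = u
      · simpa [hwu, GuardedIn] using huv
      · simpa [hwu] using hs w ⟨hwu, hw⟩ hwv

theorem Guarded.subst {e : RawTerm A} {s : ℕ → RawTerm A} (h : e.Guarded) (hc : e.CaptureFree s)
    (hs : ∀ w ∈ e.fv, (s w).Guarded) : (e.subst s).Guarded := by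
  induction e generalizing s with
  | var w => exact hs w (by simp [fv])
  | act a e ih => exact ih h hc hs
  | add e₁ e₂ ih₁ ih₂ =>
    simp only [fv, Finset.mem_union] at hs
    exact ⟨ih₁ h.1 hc.1 fun v hv => hs v (.inl hv), ih₂ h.2 hc.2 fun v hv => hs v (.inr hv)⟩
  | mu u e ih =>
    simp only [fv, Finset.mem_erase] at hs
    refine ⟨h.1.subst fun w hw hwu => ?_, ih h.2 hc.2 fun w hw => ?_⟩
    · rw [Function.update_of_ne hwu]
      exact guardedIn_of_notMem_fv (hc.1 w hw hwu)
    · by_cases hwu : w = u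
      · simp [hwu, Guarded]
      · simpa [hwu] using hs w ⟨hwu, hw⟩

theorem Guarded.isProc_subst {e : RawTerm A} {s : ℕ → RawTerm A} (h : e.Guarded)
    (hs : ∀ w ∈ e.fv, (s w).IsProc) : (e.subst s).IsProc :=
  ⟨fv_subst_eq_empty fun w hw => (hs w hw).1,
    h.subst (captureFree_of_closed fun w hw => .inr (hs w hw).1) fun w hw => (hs w hw).2⟩

theorem IsProc.unfold {v : ℕ} {e : RawTerm A} (h : (mu v e).IsProc) :
    (e.subst₁ (mu v e) v).IsProc := by
  refine Guarded.isProc_subst h.2.2 fun w hw => ?_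
  have hwv : w = v := by
    by_contra hwv
    have : w ∈ (mu v e).fv := by simp [fv, hw, hwv]
    simp [h.1] at this
  simpa [hwv] using h

theorem isProc_add {e₁ e₂ : RawTerm A} : (add e₁ e₂).IsProc ↔ e₁.IsProc ∧ e₂.IsProc := by
  simp only [IsProc, fv, Guarded, Finset.union_eq_empty]
  tauto

theorem Step.isProc {e f : RawTerm A} {a : A} (h : Step e a f) (he : e.IsProc) : f.IsProc := by
  induction h with
  | act a e => exact he
  | left _ ih => exact ih (isProc_add.1 he).1
  | right _ ih => exact ih (isProc_add.1 he).2
  | mu _ ih => exact ih he.unfold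

/-- The nesting depth of sums and binders above the outermost action prefixes. Unfolding a guarded
fixed point decreases it, which makes it the measure for inductions along the transition rules. -/
def unguardedDepth : RawTerm A → ℕ
  | var _ => 0
  | act _ _ => 0
  | add e₁ e₂ => max e₁.unguardedDepth e₂.unguardedDepth + 1
  | mu _ e => e.unguardedDepth + 1

theorem unguardedDepth_subst {e : RawTerm A} {s : ℕ → RawTerm A}
    (h : ∀ v, ¬ GuardedIn v e → s v = var v) :
    (e.subst s).unguardedDepth = e.unguardedDepth := by
  induction e generalizing s with
  | var v => rw [subst, h v (by simp [GuardedIn])]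
  | act a e ih => rfl
  | add e₁ e₂ ih₁ ih₂ =>
    simp only [subst, unguardedDepth]
    rw [ih₁ fun v hv => h v fun h' => hv h'.1, ih₂ fun v hv => h v fun h' => hv h'.2]
  | mu u e ih =>
    simp only [subst, unguardedDepth]
    rw [ih fun v hv => ?_]
    by_cases hvu : v = u
    · simp [hvu]
    · rw [Function.update_of_ne hvu]
      exact h v fun h' => h'.elim (fun h => hvu h.symm) hv

theorem unguardedDepth_unfold {v : ℕ} {e g : RawTerm A} (h : GuardedIn v e) :
    (e.subst₁ g v).unguardedDepth = e.unguardedDepth := by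
  refine unguardedDepth_subst fun w hw => ?_
  have : w ≠ v := fun hwv => hw (hwv ▸ h)
  simp [this]

/-- Induction principle for closed guarded terms in which the fixed point `μ v e` is reduced to its
unfolding. -/
theorem IsProc.induction {P : RawTerm A → Prop} (act : ∀ a e, e.IsProc → P (act a e))
    (add : ∀ e₁ e₂, e₁.IsProc → e₂.IsProc → P e₁ → P e₂ → P (add e₁ e₂))
    (mu : ∀ v e, (mu v e).IsProc → P (e.subst₁ (mu v e) v) → P (mu v e))
    {e : RawTerm A} (he : e.IsProc) : P e := by
  induction hn : e.unguardedDepth using Nat.strong_induction_on generalizing e with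
  | _ n ih =>
    cases e with
    | var v => simp [IsProc, fv] at he
    | act a e => exact act a e he
    | add e₁ e₂ =>
      have h := isProc_add.1 he
      simp only [unguardedDepth] at hn
      exact add _ _ h.1 h.2 (ih _ (by omega) h.1 rfl) (ih _ (by omega) h.2 rfl)
    | mu v e =>
      refine mu v e he (ih _ ?_ he.unfold rfl)
      rw [unguardedDepth_unfold he.2.1, ← hn]
      exact Nat.lt_succ_self _

/-! ### Unique solutions of guarded systems of equations -/

theorem Derivable.add_congr {e₁ e₂ f₁ f₂ : RawTerm A} (h₁ : Derivable e₁ f₁)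
    (h₂ : Derivable e₂ f₂) (he : (add e₁ e₂).IsProc) (hf : (add f₁ f₂).IsProc) :
    Derivable (add e₁ e₂) (add f₁ f₂) := by
  have := Derivable.cn (g := add (var 0) (var 1)) (s := fun n => if n = 0 then e₁ else e₂)
    (t := fun n => if n = 0 then f₁ else f₂) (by simp [fv, h₁, h₂])
    (by simpa [subst] using he) (by simpa [subst] using hf)
  simpa [subst] using this

theorem Derivable.act_congr {e f : RawTerm A} (a : A) (h : Derivable e f) (he : e.IsProc)
    (hf : f.IsProc) : Derivable (act a e) (act a f) :=
  Derivable.cn (g := act a (var 0)) (s := fun _ => e) (t := fun _ => f) (fun _ _ => h) he hf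

/-- A guarded system of equations `xᵢ = E i`, `i < n`, has at most one solution up to derivable
equivalence. The unknowns are eliminated one after the other, the last one first: by (UA) its value
is `μ n (E n)`, which is then substituted for it in the remaining equations. The bound variables
introduced in this way are at least `n`, whereas the unknowns left over are less than `n`, so that
nothing is captured. -/
theorem derivable_of_solution {n : ℕ} {E g h : ℕ → RawTerm A}
    (hfv : ∀ i < n, ∀ j ∈ (E i).fv, j < n) (hb : ∀ i < n, (E i).BindersGE n)
    (hE : ∀ i < n, (E i).Guarded) (hguard : ∀ i < n, ∀ j, GuardedIn j (E i))
    (hg : ∀ i < n, (g i).IsProc) (hh : ∀ i < n, (h i).IsProc)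
    (hgE : ∀ i < n, Derivable (g i) ((E i).subst g))
    (hhE : ∀ i < n, Derivable (h i) ((E i).subst h)) :
    ∀ i < n, Derivable (g i) (h i) := by
  induction n generalizing E with
  | zero => simp
  | succ n ih =>
    set t : RawTerm A := mu n (E n) with ht
    have htg : t.Guarded := ⟨hguard n n.lt_succ_self n, hE n n.lt_succ_self⟩
    have htfv : ∀ j ∈ t.fv, j < n := fun j hj => by
      simp only [ht, fv, Finset.mem_erase] at hj
      have := hfv n n.lt_succ_self j hj.2
      omega
    -- The last equation is solved by `t` in terms of the values of the other unknowns.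
    have last : ∀ g : ℕ → RawTerm A, (∀ i < n + 1, (g i).IsProc) →
        Derivable (g n) ((E n).subst g) → Derivable (g n) (t.subst g) := fun g hg hgn => by
      refine Derivable.ua ?_ (htg.isProc_subst fun w hw => hg w ((htfv w hw).trans n.lt_succ_self))
      rw [subst_update_subst₁ fun w hw _ => (hg w (hfv n n.lt_succ_self w hw)).1,
        Function.update_eq_self]
      exact hgn
    have rest : ∀ g : ℕ → RawTerm A, (∀ i < n + 1, (g i).IsProc) →
        (∀ i < n + 1, Derivable (g i) ((E i).subst g)) →
        ∀ i < n, Derivable (g i) (((E i).subst₁ t n).subst g) := fun g hg hgE i hi => by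
      have hi' := hi.trans n.lt_succ_self
      have hp : ∀ w ∈ (E i).fv, ((Function.update var n t w).subst g).IsProc := fun w hw => by
        by_cases hwn : w = n
        · subst hwn
          rw [Function.update_self]
          exact htg.isProc_subst fun w hw => hg w ((htfv w hw).trans (Nat.lt_succ_self _))
        · simpa [hwn, subst] using hg w (hfv i hi' w hw)
      rw [subst₁, CaptureFree.subst_subst]
      · refine (hgE i hi').trans (Derivable.cn (fun w hw => ?_)
          ((hE i hi').isProc_subst fun w hw => hg w (hfv i hi' w hw))
          ((hE i hi').isProc_subst hp))
        by_cases hwn : w = n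
        · subst hwn
          simpa using last g hg (hgE _ (Nat.lt_succ_self _))
        · simpa [hwn, subst] using Derivable.refl (hg w (hfv i hi' w hw))
      · refine (hb i hi').captureFree fun w _ => ?_
        by_cases hwn : w = n
        · subst hwn
          exact .inr fun u hu => by simpa using (htfv u (by simpa using hu)).trans (Nat.lt_succ_self _)
        · simp [hwn]
    have key : ∀ i < n, Derivable (g i) (h i) := by
      refine ih (E := fun i => (E i).subst₁ t n) (fun i hi j hj => ?_) (fun i hi => ?_)
        (fun i hi => ?_) (fun i hi j => ?_) (fun i hi => hg i (by omega))
        (fun i hi => hh i (by omega)) (rest g hg hgE) (rest h hh hhE)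
      · obtain ⟨w, hw, hj⟩ := exists_of_mem_fv_subst hj
        by_cases hwn : w = n
        · subst hwn
          exact htfv j (by simpa using hj)
        · simp only [Function.update_of_ne hwn, fv, Finset.mem_singleton] at hj
          have := hfv i (by omega) w hw
          omega
      · refine ((hb i (by omega)).mono n.le_succ).subst fun w _ => ?_
        by_cases hwn : w = n
        · subst hwn
          rw [Function.update_self]
          exact ⟨le_rfl, (hb w (by omega)).mono (Nat.le_succ w)⟩
        · simp [hwn, BindersGE]
      · refine (hE i (by omega)).subst ((hb i (by omega)).captureFree fun w _ => ?_) fun w _ => ?_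
        · by_cases hwn : w = n
          · subst hwn
            exact .inr fun u hu => by
              simpa using (htfv u (by simpa using hu)).trans (Nat.lt_succ_self _)
          · simp [hwn]
        · by_cases hwn : w = n
          · subst hwn
            simpa using htg
          · simp [hwn, Guarded]
      · refine (hguard i (by omega) j).subst fun w _ hwj => ?_
        by_cases hwn : w = n
        · subst hwn
          rw [Function.update_self]
          exact .inr (hguard w (by omega) j)
        · simpa [hwn, GuardedIn] using hwj
    intro i hi
    rcases (Nat.lt_succ_iff_lt_or_eq.1 hi) with hi | rfl
    · exact key i hi
    · refine (last g hg (hgE i hi)).trans (.trans (Derivable.cn (fun w hw => key w (htfv w hw))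
        ?_ ?_) (last h hh (hhE i hi)).symm)
      · exact htg.isProc_subst fun w hw => hg w ((htfv w hw).trans hi)
      · exact htg.isProc_subst fun w hw => hh w ((htfv w hw).trans hi)

/-! ### Finiteness of the set of derivatives -/

/-- A finite set containing the derivatives of `e.subst s` that do not arise from the substituted
terms: the instances of the subterms of `e` below an action prefix, with each variable bound in `e`
replaced by the corresponding fixed point. -/
def derivs : RawTerm A → (ℕ → RawTerm A) → Set (RawTerm A)
  | var _, _ => ∅
  | act _ e, s => insert (e.subst s) (e.derivs s)
  | add e₁ e₂, s => e₁.derivs s ∪ e₂.derivs s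
  | mu v e, s => e.derivs (Function.update s v ((mu v e).subst s))

theorem finite_derivs (e : RawTerm A) (s : ℕ → RawTerm A) : (e.derivs s).Finite := by
  induction e generalizing s with
  | var v => exact Set.finite_empty
  | act a e ih => exact (ih s).insert _
  | add e₁ e₂ ih₁ ih₂ => exact (ih₁ s).union (ih₂ s)
  | mu v e ih => exact ih _

/-- By guardedness, a first step can only come from a substituted term at an unguarded variable. In
the case of `μ u e`, this excludes the variable `u`, whose value is the fixed point itself. -/
theorem Step.mem_derivs {e f : RawTerm A} {s : ℕ → RawTerm A} {a : A} (he : e.Guarded)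
    (hs : ∀ v ∈ e.fv, (s v).fv = ∅) (h : Step (e.subst s) a f) :
    f ∈ e.derivs s ∨ ∃ v ∈ e.fv, ¬ GuardedIn v e ∧ Step (s v) a f := by
  induction e generalizing s with
  | var v => exact .inr ⟨v, by simp [fv], by simp [GuardedIn], h⟩
  | act b e ih =>
    cases h
    exact .inl (.inl rfl)
  | add e₁ e₂ ih₁ ih₂ =>
    simp only [fv, Finset.mem_union] at hs ⊢
    cases h with
    | left h =>
      rcases ih₁ he.1 (fun v hv => hs v (.inl hv)) h with h | ⟨v, hv, hg, h⟩
      · exact .inl (.inl h)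
      · exact .inr ⟨v, .inl hv, fun h' => hg h'.1, h⟩
    | right h =>
      rcases ih₂ he.2 (fun v hv => hs v (.inr hv)) h with h | ⟨v, hv, hg, h⟩
      · exact .inl (.inr h)
      · exact .inr ⟨v, .inr hv, fun h' => hg h'.2, h⟩
  | mu u e ih =>
    have hm : ((RawTerm.mu u e).subst s).fv = ∅ := fv_subst_eq_empty hs
    simp only [fv, Finset.mem_erase] at hs ⊢
    cases h with
    | mu h =>
      rw [subst_update_subst₁ fun w hw hwu => hs w ⟨hwu, hw⟩] at h
      have hs' : ∀ w ∈ e.fv, (Function.update s u ((RawTerm.mu u e).subst s) w).fv = ∅ :=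
        fun w hw => by
          by_cases hwu : w = u
          · subst hwu
            rwa [Function.update_self]
          · simpa [hwu] using hs w ⟨hwu, hw⟩
      rcases ih he.2 hs' h with h | ⟨v, hv, hg, h⟩
      · exact .inl h
      · have hvu : v ≠ u := fun hvu => hg (hvu ▸ he.1)
        rw [Function.update_of_ne hvu] at h
        exact .inr ⟨v, ⟨hvu, hv⟩, fun h' => h'.elim (fun h => hvu h.symm) hg, h⟩

theorem Step.mem_derivs_of_mem_derivs {e f f' : RawTerm A} {s : ℕ → RawTerm A} {a : A}
    (he : e.Guarded) (hs : ∀ v ∈ e.fv, (s v).fv = ∅) (hf : f ∈ e.derivs s) (h : Step f a f') :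
    f' ∈ e.derivs s ∨ ∃ v ∈ e.fv, Step (s v) a f' := by
  induction e generalizing s with
  | var v => exact hf.elim
  | act b e ih =>
    rcases hf with rfl | hf
    · rcases Step.mem_derivs (e := e) he hs h with h | ⟨v, hv, -, h⟩
      · exact .inl (.inr h)
      · exact .inr ⟨v, hv, h⟩
    · exact (ih he hs hf).imp_left .inr
  | add e₁ e₂ ih₁ ih₂ =>
    simp only [fv, Finset.mem_union] at hs ⊢
    rcases hf with hf | hf
    · rcases ih₁ he.1 (fun v hv => hs v (.inl hv)) hf with h | ⟨v, hv, h⟩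
      · exact .inl (.inl h)
      · exact .inr ⟨v, .inl hv, h⟩
    · rcases ih₂ he.2 (fun v hv => hs v (.inr hv)) hf with h | ⟨v, hv, h⟩
      · exact .inl (.inr h)
      · exact .inr ⟨v, .inr hv, h⟩
  | mu u e ih =>
    have hm : ((RawTerm.mu u e).subst s).fv = ∅ := fv_subst_eq_empty hs
    have hs' : ∀ w ∈ e.fv, (Function.update s u ((RawTerm.mu u e).subst s) w).fv = ∅ :=
      fun w hw => by
        by_cases hwu : w = u
        · subst hwu
          rwa [Function.update_self]
        · simpa [hwu] using hs w (by simp [fv, hwu, hw])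
    rcases ih he.2 hs' hf with h | ⟨v, hv, h⟩
    · exact .inl h
    · by_cases hvu : v = u
      · subst hvu
        rw [Function.update_self] at h
        rcases h.mem_derivs he hs with h | ⟨v, hv, -, h⟩
        · exact .inl h
        · exact .inr ⟨v, hv, h⟩
      · rw [Function.update_of_ne hvu] at h
        exact .inr ⟨v, by simp [fv, hvu, hv], h⟩
end RawTerm

namespace ProcTerm

variable {A : Type u}

/-- Every process term has finitely many derivatives. -/
theorem exists_finite_closed (e : ProcTerm A) :
    ∃ D : Set (ProcTerm A), D.Finite ∧ e ∈ D ∧ ∀ f ∈ D, ∀ p ∈ γ f, p.2 ∈ D := by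
  have hs : ∀ v ∈ e.1.fv, (RawTerm.var v : RawTerm A).fv = ∅ := by simp [e.2.1]
  refine ⟨insert e (Subtype.val ⁻¹' e.1.derivs RawTerm.var),
    ((RawTerm.finite_derivs _ _).preimage Subtype.val_injective.injOn).insert _, .inl rfl, ?_⟩
  rintro f (rfl | hf) p hp
  · rcases RawTerm.Step.mem_derivs (s := RawTerm.var) f.2.2 hs (by rw [RawTerm.subst_var]; exact hp)
      with h | ⟨v, hv, -⟩
    · exact .inr h
    · simp [f.2.1] at hv
  · rcases RawTerm.Step.mem_derivs_of_mem_derivs (s := RawTerm.var) e.2.2 hs hf hp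
      with h | ⟨v, hv, -⟩
    · exact .inr h
    · simp [e.2.1] at hv

end ProcTerm

/-! ### Streams and traces -/

/-- The stream with first letter `a` followed by the stream `s`. -/
def streamCons {A : Type u} (a : A) (s : ℕ → A) : ℕ → A
  | 0 => a
  | n + 1 => s n

theorem streamPrefix_succ {A : Type u} (s : ℕ → A) (n : ℕ) :
    streamPrefix s (n + 1) = s 0 :: streamPrefix (fun k => s (k + 1)) n := by
  simp [streamPrefix, List.range_succ_eq_map, Function.comp_def]

/-- In a transition system without deadlock, traces extend to streams. -/
theorem LTS.exists_mem_str {A X : Type u} {α : LTS A X} (hα : ∀ x, (α x).Nonempty) {w : List A}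
    {x : X} (hw : w ∈ α.tr x) : ∃ s ∈ α.str x, streamPrefix s w.length = w := by
  induction w generalizing x with
  | nil =>
    choose p hp using hα
    refine ⟨fun n => (p ((fun y => (p y).2)^[n] x)).1, fun n => ?_, rfl⟩
    induction n generalizing x with
    | zero => trivial
    | succ n ih =>
      rw [streamPrefix_succ]
      exact ⟨_, hp x, ih (x := (p x).2) trivial⟩
  | cons a w ih =>
    obtain ⟨y, hxy, hy⟩ := hw
    obtain ⟨s, hs, hsw⟩ := ih hy
    refine ⟨streamCons a s, fun n => ?_, ?_⟩
    · cases n with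
      | zero => trivial
      | succ n =>
        rw [streamPrefix_succ]
        exact ⟨y, hxy, hs n⟩
    · rw [List.length_cons, streamPrefix_succ]
      exact congrArg (a :: ·) hsw

theorem LTS.tr_subset_of_str_subset {A X : Type u} {α : LTS A X} (hα : ∀ x, (α x).Nonempty)
    {x y : X} (h : α.str x ⊆ α.str y) : α.tr x ⊆ α.tr y := fun w hw => by
  obtain ⟨s, hs, hsw⟩ := LTS.exists_mem_str hα hw
  rw [← hsw]
  exact h hs _

/-! ### The space of streams -/

section StreamSpace

variable {B : Type v} [TopologicalSpace B] [DiscreteTopology B]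

attribute [local instance] PiNat.metricSpace

theorem contractingWith_streamCons (b : B) :
    ContractingWith (1 / 2) (streamCons b : (ℕ → B) → ℕ → B) := by
  refine ⟨by rw [← NNReal.coe_lt_coe]; norm_num, LipschitzWith.of_dist_le_mul fun x y => ?_⟩
  rcases eq_or_ne x y with rfl | hxy
  · simp
  · have : dist (streamCons b x) (streamCons b y) ≤ (1 / 2) ^ (PiNat.firstDiff x y + 1) := by
      refine PiNat.mem_cylinder_iff_dist_le.1 (PiNat.mem_cylinder_iff.2 fun i hi => ?_)
      cases i with
      | zero => rfl
      | succ i => exact PiNat.apply_eq_of_lt_firstDiff (x := x) (y := y) (by omega)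
    rw [PiNat.dist_eq_of_ne hxy]
    refine this.trans_eq ?_
    rw [pow_succ', NNReal.coe_div, NNReal.coe_one, NNReal.coe_ofNat]

/-- The interpretation of an action by prefixing its image under `φ` to streams. -/
def consOp {A : Type u} (φ : A → B) (a : A) : ContractionOp (ℕ → B) :=
  ⟨streamCons (φ a), _, contractingWith_streamCons (φ a)⟩

theorem applyWord_consOp_streamPrefix {A : Type u} (φ : A → B) (s : ℕ → A) (x : ℕ → B) {n k : ℕ}
    (hk : k < n) : applyWord (consOp φ) (streamPrefix s n) x k = φ (s k) := by
  induction n generalizing s k with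
  | zero => omega
  | succ n ih =>
    rw [streamPrefix_succ]
    cases k with
    | zero => rfl
    | succ k => exact ih (fun k => s (k + 1)) (Nat.lt_of_succ_lt_succ hk)

theorem isStreamPoint_consOp {A : Type u} (φ : A → B) (s : ℕ → A) :
    IsStreamPoint (consOp φ) s (φ ∘ s) := fun x => by
  refine tendsto_pi_nhds.2 fun k => tendsto_const_nhds.congr' ?_
  filter_upwards [eventually_gt_atTop k] with n hn
  exact (applyWord_consOp_streamPrefix φ s x hn).symm

theorem LTS.mem_str_of_mem_sem_consOp {A X : Type u} {φ : A → B} (hφ : Function.Injective φ)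
    {α : LTS A X} {x : X} {s : ℕ → A} (h : φ ∘ s ∈ α.sem (consOp φ) x) : s ∈ α.str x := by
  obtain ⟨t, ht, hts⟩ := h
  have := tendsto_nhds_unique (hts (φ ∘ s)) (isStreamPoint_consOp φ t (φ ∘ s))
  rwa [hφ.comp_left this]

end StreamSpace

/-- Fractally equivalent process terms emit the same streams: the space of streams over the action
alphabet, with the interpretation of actions as prefixing, recovers the emitted streams. -/
theorem ProcTerm.FractalEquiv.str_eq {A : Type u} [Finite A] {e f : ProcTerm A}
    (h : ProcTerm.FractalEquiv.{u, v} e f) : γ.str e = γ.str f := by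
  -- A copy of the alphabet in the universe over which the metric spaces range.
  obtain ⟨n, ⟨ε⟩⟩ := Finite.exists_equiv_fin A
  let B := ULift.{v} (Fin n)
  let : TopologicalSpace B := ⊥
  have : DiscreteTopology B := ⟨rfl⟩
  let : MetricSpace (ℕ → B) := PiNat.metricSpace
  have : CompleteSpace (ℕ → B) := PiNat.completeSpace
  let φ : A → B := fun a => ULift.up (ε a)
  have hφ : Function.Injective φ := fun a b hab => ε.injective (congrArg ULift.down hab)
  have := h (ℕ → B) (consOp φ)
  ext s
  constructor
  · intro hs
    refine LTS.mem_str_of_mem_sem_consOp hφ (?_ : _ ∈ f.sem (consOp φ))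
    rw [← this]
    exact ⟨s, hs, isStreamPoint_consOp φ s⟩
  · intro hs
    refine LTS.mem_str_of_mem_sem_consOp hφ (?_ : _ ∈ e.sem (consOp φ))
    rw [this]
    exact ⟨s, hs, isStreamPoint_consOp φ s⟩

namespace ProcTerm

variable {A : Type u}

/-! ### The semilattice of process terms up to provable equivalence -/

/-- Provable equivalence as a setoid on process terms. -/
instance provSetoid (A : Type u) : Setoid (ProcTerm A) where
  r := ProvEquiv
  iseqv := ⟨fun e => .refl e.2, .symm, .trans⟩

/-- Process terms up to provable equivalence. -/
def ProvClass (A : Type u) : Type u := Quotient (provSetoid A)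

/-- The class of a process term modulo provable equivalence. -/
def cls (e : ProcTerm A) : ProvClass A := Quotient.mk _ e

theorem cls_eq_cls {e f : ProcTerm A} : cls e = cls f ↔ ProvEquiv e f :=
  Quotient.eq (r := provSetoid A)

theorem cls_surjective : Function.Surjective (cls : ProcTerm A → ProvClass A) :=
  Quotient.mk_surjective

/-- The sum of process terms. -/
def add (e f : ProcTerm A) : ProcTerm A := ⟨.add e.1 f.1, RawTerm.isProc_add.2 ⟨e.2, f.2⟩⟩

/-- The action prefix of a process term. -/
def act (a : A) (e : ProcTerm A) : ProcTerm A := ⟨.act a e.1, e.2⟩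

/-- By (ID), (CM) and (AS), addition makes provable equivalence classes a semilattice. -/
instance : SemilatticeSup (ProvClass A) :=
  letI : Max (ProvClass A) := ⟨Quotient.map₂ add fun _ _ h₁ _ _ h₂ =>
    RawTerm.Derivable.add_congr h₁ h₂ (add _ _).2 (add _ _).2⟩
  SemilatticeSup.mk'
    (by rintro ⟨e⟩ ⟨f⟩; exact Quotient.sound (RawTerm.Derivable.cm f.2 e.2))
    (by rintro ⟨e⟩ ⟨f⟩ ⟨g⟩; exact Quotient.sound (RawTerm.Derivable.as e.2 f.2 g.2).symm)
    (by rintro ⟨e⟩; exact Quotient.sound (RawTerm.Derivable.id e.2))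

/-- Action prefixes preserve binary joins, by (DS). -/
def actHom (a : A) : SupHom (ProvClass A) (ProvClass A) where
  toFun := Quotient.map (act a) fun e f h => RawTerm.Derivable.act_congr a h e.2 f.2
  map_sup' := by rintro ⟨e⟩ ⟨f⟩; exact Quotient.sound (RawTerm.Derivable.ds e.2 f.2)

theorem _root_.Finset.isLUB_image_sup' {ι α : Type*} [SemilatticeSup α] {s : Finset ι}
    (hs : s.Nonempty) (f : ι → α) : IsLUB (f '' s) (s.sup' hs f) :=
  ⟨by rintro _ ⟨i, hi, rfl⟩; exact Finset.le_sup' f hi,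
    fun _ hb => Finset.sup'_le hs f fun i hi => hb ⟨i, hi, rfl⟩⟩

theorem isLUB_actHom (a : A) {S : Set (ProvClass A)} (hS : S.Finite) (hne : S.Nonempty)
    {q : ProvClass A} (hq : IsLUB S q) : IsLUB (actHom a '' S) (actHom a q) := by
  lift S to Finset (ProvClass A) using hS
  have hS := Finset.isLUB_image_sup' hne id
  rw [Set.image_id] at hS
  rw [hq.unique hS, map_finset_sup' (actHom a) hne id]
  exact Finset.isLUB_image_sup' hne _

/-- A nonempty finite set of process terms has a sum, which is again a process term. -/
theorem exists_isLUB_cls {S : Set (ProcTerm A)} (hS : S.Finite) (hne : S.Nonempty) :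
    ∃ g : ProcTerm A, IsLUB (cls '' S) (cls g) := by
  lift S to Finset (ProcTerm A) using hS
  obtain ⟨g, hg⟩ := cls_surjective (S.sup' hne cls)
  exact ⟨g, hg ▸ Finset.isLUB_image_sup' hne cls⟩

/-! ### Process terms as sums over their transitions -/

/-- Process terms do not deadlock. -/
theorem γ_nonempty (e : ProcTerm A) : (γ e).Nonempty := by
  suffices ∃ a f, RawTerm.Step e.1 a f by
    obtain ⟨a, f, h⟩ := this
    exact ⟨(a, ⟨f, h.isProc e.2⟩), h⟩
  refine RawTerm.IsProc.induction (P := fun e => ∃ a f, RawTerm.Step e a f)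
    (fun a e _ => ⟨a, e, .act a e⟩) ?_ ?_ e.2
  · rintro e₁ e₂ - - ⟨a, f, h⟩ -
    exact ⟨a, f, .left h⟩
  · rintro v e - ⟨a, f, h⟩
    exact ⟨a, f, .mu h⟩

/-- Every process term is provably equivalent to the sum over its transitions. -/
theorem isLUB_cls (e : ProcTerm A) :
    IsLUB ((fun p : A × ProcTerm A => actHom p.1 (cls p.2)) '' γ e) (cls e) := by
  suffices ∀ he : e.1.IsProc,
      IsLUB ((fun p : A × ProcTerm A => actHom p.1 (cls p.2)) '' γ ⟨e.1, he⟩) (cls ⟨e.1, he⟩) from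
    this e.2
  refine RawTerm.IsProc.induction (P := fun e => ∀ he : e.IsProc,
      IsLUB ((fun p : A × ProcTerm A => actHom p.1 (cls p.2)) '' γ ⟨e, he⟩) (cls ⟨e, he⟩))
    ?_ ?_ ?_ e.2
  · intro a e he he'
    have : γ (⟨.act a e, he'⟩ : ProcTerm A) = {(a, ⟨e, he⟩)} := by
      ext ⟨b, f, hf⟩
      constructor
      · intro h
        cases h
        rfl
      · rintro ⟨⟩
        exact .act _ _
    rw [this, Set.image_singleton]
    exact isLUB_singleton
  · intro e₁ e₂ h₁ h₂ ih₁ ih₂ he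
    have : γ (⟨.add e₁ e₂, he⟩ : ProcTerm A) = γ ⟨e₁, h₁⟩ ∪ γ ⟨e₂, h₂⟩ := by
      ext p
      constructor
      · intro h
        cases h with
        | left h => exact .inl h
        | right h => exact .inr h
      · rintro (h | h)
        · exact .left h
        · exact .right h
    rw [this, Set.image_union]
    exact (ih₁ h₁).union (ih₂ h₂)
  · intro v e he ih _
    have : γ (⟨.mu v e, he⟩ : ProcTerm A) = γ ⟨e.subst₁ (.mu v e) v, he.unfold⟩ := by
      ext p
      constructor
      · intro h
        cases h with
        | mu h => exact h
      · exact .mu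
    rw [this, (cls_eq_cls.2 (RawTerm.Derivable.fp he) :
      cls ⟨.mu v e, he⟩ = cls ⟨_, he.unfold⟩)]
    exact ih he.unfold

/-! ### Determinization -/

/-- The states reached by an `a`-transition from a state in `S`. -/
def succs (a : A) (S : Set (ProcTerm A)) : Set (ProcTerm A) := {f | ∃ e ∈ S, (a, f) ∈ γ e}

/-- The traces emitted by the states in `S`. -/
def traces (S : Set (ProcTerm A)) : Set (List A) := ⋃ e ∈ S, γ.tr e

theorem mem_traces_succs {a : A} {S : Set (ProcTerm A)} {w : List A} :
    w ∈ traces (succs a S) ↔ a :: w ∈ traces S := by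
  simp only [traces, succs, LTS.tr, LTS.EmitsWord, Set.mem_iUnion, Set.mem_ofPred_eq]
  constructor
  · rintro ⟨f, ⟨e, he, hf⟩, hw⟩
    exact ⟨e, he, f, hf, hw⟩
  · rintro ⟨e, he, f, hf, hw⟩
    exact ⟨f, ⟨e, he, hf⟩, hw⟩

theorem nonempty_iff_nil_mem_traces {S : Set (ProcTerm A)} : S.Nonempty ↔ [] ∈ traces S := by
  simp [traces, LTS.tr, LTS.EmitsWord, Set.Nonempty]

/-- The sum of the terms in `S` is the sum over the letters `a` of the `a`-prefixes of the sums of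
the terms in `succs a S`. -/
theorem isLUB_succs {S : Set (ProcTerm A)} {q : ProvClass A} (hq : IsLUB (cls '' S) q)
    {P : Set (A × ProvClass A)} (hfin : ∀ a, (succs a S).Finite)
    (hP : ∀ p ∈ P, (succs p.1 S).Nonempty ∧ IsLUB (cls '' succs p.1 S) p.2)
    (hex : ∀ a, (succs a S).Nonempty → ∃ r, (a, r) ∈ P) :
    IsLUB ((fun p : A × ProvClass A => actHom p.1 p.2) '' P) q := by
  constructor
  · rintro _ ⟨⟨a, r⟩, hp, rfl⟩
    refine (isLUB_actHom a ((hfin a).image _) ((hP _ hp).1.image _) (hP _ hp).2).2 ?_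
    rintro _ ⟨_, ⟨f, ⟨e, he, hf⟩, rfl⟩, rfl⟩
    exact ((isLUB_cls e).1 ⟨_, hf, rfl⟩).trans (hq.1 ⟨e, he, rfl⟩)
  · intro b hb
    refine hq.2 ?_
    rintro _ ⟨e, he, rfl⟩
    refine (isLUB_cls e).2 ?_
    rintro _ ⟨⟨a, f⟩, hf, rfl⟩
    have hf' : f ∈ succs a S := ⟨e, he, hf⟩
    obtain ⟨r, hr⟩ := hex a ⟨f, hf'⟩
    exact (OrderHomClass.mono (actHom a) ((hP _ hr).2.1 ⟨f, hf', rfl⟩)).trans (hb ⟨_, hr, rfl⟩)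

/-- The sum of a nonempty finite set of monomials `a xᵢ`, as a term in the variables `xᵢ`. -/
theorem exists_linear_term {l : Finset (A × ℕ)} (hl : l.Nonempty) :
    ∃ E : RawTerm A, (∀ i ∈ E.fv, ∃ p ∈ l, p.2 = i) ∧ (∀ k, E.BindersGE k) ∧ E.Guarded ∧
      (∀ i, RawTerm.GuardedIn i E) ∧ ∀ s : ℕ → ProcTerm A, ∃ h : (E.subst fun i => (s i).1).IsProc,
        IsLUB ((fun p : A × ℕ => actHom p.1 (cls (s p.2))) '' l) (cls ⟨_, h⟩) := by
  induction hl using Finset.Nonempty.cons_induction with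
  | singleton p =>
    refine ⟨.act p.1 (.var p.2), by simp [RawTerm.fv], fun _ => trivial, trivial, fun _ => trivial,
      fun s => ⟨(s p.2).2, ?_⟩⟩
    rw [Finset.coe_singleton, Set.image_singleton]
    exact isLUB_singleton
  | cons p l hp hl ih =>
    obtain ⟨E, hfv, hb, hE, hg, hlub⟩ := ih
    refine ⟨.add (.act p.1 (.var p.2)) E, fun i hi => ?_, fun k => ⟨trivial, hb k⟩, ⟨trivial, hE⟩,
      fun i => ⟨trivial, hg i⟩, fun s => ?_⟩
    · simp only [RawTerm.fv, Finset.mem_union, Finset.mem_singleton] at hi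
      rcases hi with rfl | hi
      · exact ⟨p, by simp⟩
      · obtain ⟨p', hp', h⟩ := hfv i hi
        exact ⟨p', by simp [hp'], h⟩
    · obtain ⟨h, hE⟩ := hlub s
      refine ⟨(add (act p.1 (s p.2)) ⟨_, h⟩).2, ?_⟩
      rw [Finset.coe_cons, Set.image_insert_eq]
      exact hE.insert _

/-- Process terms with the same traces are provably equivalent: the pairs of sets of derivatives
of `e` and of `f` with equal traces index a finite guarded system of equations, which is solved by
the sums of the first components as well as by those of the second ones. -/
theorem provEquiv_of_tr_eq [Finite A] {e f : ProcTerm A} (h : γ.tr e = γ.tr f) :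
    ProvEquiv e f := by
  obtain ⟨D₁, hD₁, he, hc₁⟩ := exists_finite_closed e
  obtain ⟨D₂, hD₂, hf, hc₂⟩ := exists_finite_closed f
  -- `J` consists of all pairs of sets of derivatives with equal traces, reachable or not.
  let J := {p : Set (ProcTerm A) × Set (ProcTerm A) // p ∈ D₁.powerset ×ˢ D₂.powerset ∧
    p.1.Nonempty ∧ p.2.Nonempty ∧ traces p.1 = traces p.2}
  have : Finite J := ((hD₁.finite_subsets.prod hD₂.finite_subsets).subset fun p hp => hp.1).to_subtype
  obtain ⟨n, ⟨ε⟩⟩ := Finite.exists_equiv_fin J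
  have sub₁ : ∀ (j : J) a, succs a j.1.1 ⊆ D₁ := fun j a => by
    rintro y ⟨x, hx, hy⟩
    exact hc₁ x (j.2.1.1 hx) _ hy
  have sub₂ : ∀ (j : J) a, succs a j.1.2 ⊆ D₂ := fun j a => by
    rintro y ⟨x, hx, hy⟩
    exact hc₂ x (j.2.1.2 hx) _ hy
  have tr_succs : ∀ (j : J) a, traces (succs a j.1.1) = traces (succs a j.1.2) := fun j a => by
    ext w
    rw [mem_traces_succs, mem_traces_succs, j.2.2.2.2]
  have ne_iff : ∀ (j : J) a, (succs a j.1.1).Nonempty ↔ (succs a j.1.2).Nonempty := fun j a => by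
    rw [nonempty_iff_nil_mem_traces, nonempty_iff_nil_mem_traces, tr_succs]
  let next : ∀ (j : J) (a : A), (succs a j.1.1).Nonempty → J := fun j a ha =>
    ⟨(succs a j.1.1, succs a j.1.2), ⟨sub₁ j a, sub₂ j a⟩, ha, (ne_iff j a).1 ha, tr_succs j a⟩
  -- The right-hand sides of the system.
  let L : J → Set (A × ℕ) := fun j => {p | ∃ ha, p.2 = (ε (next j p.1 ha) : ℕ)}
  have hLfin : ∀ j, (L j).Finite := fun j =>
    ((Set.finite_univ (α := A)).prod (Set.finite_lt_nat n)).subset fun p hp => by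
      obtain ⟨ha, hp⟩ := hp
      exact ⟨trivial, by simp [hp]⟩
  have hLne : ∀ j, (L j).Nonempty := fun j => by
    obtain ⟨x, hx⟩ := j.2.2.1
    obtain ⟨⟨a, y⟩, hy⟩ := γ_nonempty x
    exact ⟨(a, ε (next j a ⟨y, x, hx, hy⟩)), ⟨y, x, hx, hy⟩, rfl⟩
  have hE := fun j => exists_linear_term (l := (hLfin j).toFinset) (by simpa using hLne j)
  choose E hfv hb hEg hguard hlub using hE
  let E' : ℕ → RawTerm A := fun i => if hi : i < n then E (ε.symm ⟨i, hi⟩) else .var 0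
  have hE' : ∀ j, E' (ε j) = E j := fun j => by simp [E']
  have forall_lt : ∀ {P : ℕ → Prop}, (∀ j, P (ε j)) → ∀ i < n, P i := fun {P} hP i hi => by
    simpa using hP (ε.symm ⟨i, hi⟩)
  -- A choice of sums of the sets indexed by `J` solves the system.
  have solves : ∀ (π : J → Set (ProcTerm A)), (∀ j a, (succs a (π j)).Finite) →
      (∀ j a, (succs a (π j)).Nonempty ↔ (succs a j.1.1).Nonempty) →
      (∀ j a ha, π (next j a ha) = succs a (π j)) → ∀ g : ℕ → ProcTerm A,
      (∀ j, IsLUB (cls '' π j) (cls (g (ε j)))) → ∀ j,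
      RawTerm.Derivable (g (ε j)).1 ((E' (ε j)).subst fun i => (g i).1) := by
    intro π hfin hne hnext g hg j
    obtain ⟨hp, hlub⟩ := hlub j g
    rw [hE']
    refine cls_eq_cls.1 ((isLUB_succs (hg j) (P := (fun p : A × ℕ => (p.1, cls (g p.2))) '' L j)
      (hfin j) ?_ ?_).unique ?_ : cls (g (ε j)) = cls ⟨_, hp⟩)
    · rintro _ ⟨⟨a, i⟩, ⟨ha, hi⟩, rfl⟩
      replace ha : (succs a j.1.1).Nonempty := ha
      replace hi : i = ε (next j a ha) := hi
      subst hi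
      exact ⟨(hne j a).2 ha, by simpa only [← hnext j a ha] using hg (next j a ha)⟩
    · intro a ha
      exact ⟨_, (a, ε (next j a ((hne j a).1 ha))), ⟨(hne j a).1 ha, rfl⟩, rfl⟩
    · rw [Set.image_image]
      simpa using hlub
  -- The value at indices `i ≥ n` is irrelevant.
  have extend : ∀ π : J → Set (ProcTerm A), (∀ j, (π j).Finite) → (∀ j, (π j).Nonempty) →
      ∃ g : ℕ → ProcTerm A, ∀ j, IsLUB (cls '' π j) (cls (g (ε j))) := fun π hfin hne => by
    choose g hg using fun j => exists_isLUB_cls (hfin j) (hne j)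
    exact ⟨fun i => if hi : i < n then g (ε.symm ⟨i, hi⟩) else e, fun j => by simpa using hg j⟩
  obtain ⟨g, hg⟩ := extend (fun j => j.1.1) (fun j => hD₁.subset j.2.1.1) fun j => j.2.2.1
  obtain ⟨k, hk⟩ := extend (fun j => j.1.2) (fun j => hD₂.subset j.2.1.2) fun j => j.2.2.2.1
  have := RawTerm.derivable_of_solution (n := n) (E := E') (g := fun i => (g i).1)
    (h := fun i => (k i).1)
    (forall_lt fun j i hi => by
      rw [hE'] at hi
      obtain ⟨p, hp, rfl⟩ := hfv j i hi
      obtain ⟨ha, hp⟩ := (hLfin j).mem_toFinset.1 hp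
      rw [hp]
      exact (ε _).2)
    (forall_lt fun j => by rw [hE']; exact hb j n) (forall_lt fun j => by rw [hE']; exact hEg j)
    (forall_lt fun j => by rw [hE']; exact hguard j) (fun i _ => (g i).2) (fun i _ => (k i).2)
    (forall_lt (solves _ (fun j a => hD₁.subset (sub₁ j a)) (fun _ _ => Iff.rfl)
      (fun _ _ _ => rfl) g hg))
    (forall_lt (solves _ (fun j a => hD₂.subset (sub₂ j a))
      (fun j a => (ne_iff j a).symm) (fun _ _ _ => rfl) k hk))
  -- The index of the pair whose sums are `e` and `f` themselves.
  let j₀ : J := ⟨({e}, {f}), ⟨by simpa using he, by simpa using hf⟩, by simp, by simp,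
    by simpa [traces] using h⟩
  have hge : cls (g (ε j₀)) = cls e := (hg j₀).unique (by simp [j₀])
  have hkf : cls (k (ε j₀)) = cls f := (hk j₀).unique (by simp [j₀])
  rw [← cls_eq_cls, ← hge, ← hkf, cls_eq_cls]
  exact this _ (ε j₀).2

end ProcTerm

theorem mainTheorem2 {A : Type u} [Finite A] (e f : ProcTerm A)
    (h : ProcTerm.FractalEquiv.{u, v} e f) : e.ProvEquiv f :=
  ProcTerm.provEquiv_of_tr_eq
    ((LTS.tr_subset_of_str_subset ProcTerm.γ_nonempty h.str_eq.subset).antisymm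
      (LTS.tr_subset_of_str_subset ProcTerm.γ_nonempty h.str_eq.superset))
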